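/- Let $E$ be a uniformly smooth real Banach space, i.e. for every $\varepsilon>0$ there is $\delta>0$ such that $\|x+y\|+\|x-y\|\le 2+\varepsilon\|y\|$ whenever $\|x\|=1$ and $\|y\|\le\delta$. For $w\in E$ let $h_w(x)=\|x-w\|-\|w\|$ $(x\in E)$, and call the elements of the closure of $\{h_w : w\in E\}$ in $\mathbb{R}^E$, in the topology of pointwise convergence, the metric functionals of $E$. (1) If $h$ is a metric functional of $E$ and there is a net $(a_\alpha)$ in $E$ with $\|a_\alpha\|\to\infty$ and $h_{a_\alpha}(x)\to h(x)$ for all $x\in E$, then there is a continuous linear functional $u^*\in E^*$ with $\|u^*\|\le 1$ such that $h(x)=\langle x,u^*\rangle$ for all $x\in E$. (2) Conversely, let $u^*\in E^*$ with $\|u^*\|\le 1$, and suppose that $E$ is infinite-dimensional or that $\|u^*\|=1$. Then there is a sequence $(a_n)$ in $E$ such that $h_{a_n}(x)\to\langle x,u^*\rangle$ for all $x\in E$. -/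

import Mathlib

open Filter Topology

/-- A uniformly smooth normed space: for every `ε > 0` there is `δ > 0` such that
`‖x + y‖ + ‖x - y‖ ≤ 2 + ε ‖y‖` for all `x` with `‖x‖ = 1` and all `y` with `‖y‖ ≤ δ`
(equivalently, the modulus of smoothness `ρ` satisfies `ρ(t) / t → 0` as `t → 0+`). -/
class UniformSmoothSpace (E : Type*) [SeminormedAddCommGroup E] : Prop where
  uniform_smooth : ∀ ⦃ε : ℝ⦄, 0 < ε → ∃ δ : ℝ, 0 < δ ∧ ∀ ⦃x : E⦄, ‖x‖ = 1 →
    ∀ ⦃y : E⦄, ‖y‖ ≤ δ → ‖x + y‖ + ‖x - y‖ ≤ 2 + ε * ‖y‖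

/-- The internal metric functional `h_w(x) = d(x, w) - d(o, w)` with base point `o`. -/
noncomputable def internalMetricFunctional {X : Type*} [MetricSpace X] (o w : X) : X → ℝ :=
  fun x => dist x w - dist o w

/-- The set of metric functionals of `X` with base point `o`: the closure of the set of internal
metric functionals in `X → ℝ`, which carries the topology of pointwise convergence. -/
def metricFunctionals (X : Type*) [MetricSpace X] (o : X) : Set (X → ℝ) :=
  closure (Set.range (internalMetricFunctional o))

/-! Rescaled to vectors of large norm, uniform smoothness says that second differences of the norm
over a fixed step vanish far from the origin. A limit `h` along a net going to infinity thus
satisfies Jensen's equation; since `|h x| ≤ ‖x‖`, it is linear and bounded.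

Conversely, a functional of norm one is approximated on balls by `h_a` with `a` far out, opposite to
an almost norming vector. If `‖u‖ ≤ 1` and `E` is infinite-dimensional, `u` is a weak-* limit of
norm-one functionals `u + c n • w n`, where `w n` is normalized and weak-* null. Such `w` comes from
a basic-like sequence in the dual: uniform smoothness of `E` gives uniform convexity of the dual, so
averages along subsequences tend to zero in norm. -/

theorem UniformSmoothSpace.exists_forall_norm_add_norm_sub_le {E : Type*} [NormedAddCommGroup E]
    [NormedSpace ℝ E] [UniformSmoothSpace E] {ε : ℝ} (hε : 0 < ε) :
    ∃ δ : ℝ, 0 < δ ∧ ∀ x y : E, ‖y‖ ≤ δ * ‖x‖ → ‖x + y‖ + ‖x - y‖ ≤ 2 * ‖x‖ + ε * ‖y‖ := by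
  obtain ⟨δ, hδ, H⟩ := UniformSmoothSpace.uniform_smooth (E := E) hε
  refine ⟨δ, hδ, fun x y hxy => ?_⟩
  rcases eq_or_ne x 0 with rfl | hx
  · have : y = 0 := by simpa using hxy
    simp [this]
  have hx' : 0 < ‖x‖ := norm_pos_iff.2 hx
  have h := H (x := ‖x‖⁻¹ • x) (by rw [norm_smul, norm_inv, norm_norm, inv_mul_cancel₀ hx'.ne'])
    (y := ‖x‖⁻¹ • y) (by
      rw [norm_smul, norm_inv, norm_norm, inv_mul_le_iff₀ hx']
      linarith)
  rw [← smul_add, ← smul_sub, norm_smul, norm_smul, norm_smul, norm_inv, norm_norm] at h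
  have h2 := mul_le_mul_of_nonneg_left h hx'.le
  field_simp at h2
  linarith

theorem internalMetricFunctional_zero_apply {E : Type*} [NormedAddCommGroup E] (w x : E) :
    internalMetricFunctional 0 w x = ‖x - w‖ - ‖w‖ := by
  simp [internalMetricFunctional, dist_eq_norm]

/-- Convexity of the norm gives `≥`; smoothness at `x - a i`, whose norm tends to infinity, gives
`≤`. -/
theorem UniformSmoothSpace.add_add_sub_eq_of_tendsto {E : Type*} [NormedAddCommGroup E]
    [NormedSpace ℝ E] [UniformSmoothSpace E] {ι : Type*} {l : Filter ι} [l.NeBot] {a : ι → E}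
    {h : E → ℝ} (ha : Tendsto (fun i => ‖a i‖) l atTop)
    (hh : ∀ x, Tendsto (fun i => internalMetricFunctional 0 (a i) x) l (𝓝 (h x))) (x y : E) :
    h (x + y) + h (x - y) = 2 * h x := by
  have hlim : Tendsto (fun i => internalMetricFunctional 0 (a i) (x + y)
      + internalMetricFunctional 0 (a i) (x - y) - 2 * internalMetricFunctional 0 (a i) x) l
      (𝓝 (h (x + y) + h (x - y) - 2 * h x)) :=
    ((hh _).add (hh _)).sub ((hh _).const_mul 2)
  simp only [internalMetricFunctional_zero_apply] at hlim
  have hlow : 0 ≤ h (x + y) + h (x - y) - 2 * h x := by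
    refine ge_of_tendsto' hlim fun i => ?_
    have := norm_add_le (x + y - a i) (x - y - a i)
    rw [show x + y - a i + (x - y - a i) = (2 : ℝ) • (x - a i) by module, norm_smul] at this
    norm_num at this
    linarith
  have hup : h (x + y) + h (x - y) - 2 * h x ≤ 0 := by
    refine le_of_forall_pos_le_add fun ε hε => ?_
    have hy : 0 < ‖y‖ + 1 := by positivity
    obtain ⟨δ, hδ, H⟩ :=
      UniformSmoothSpace.exists_forall_norm_add_norm_sub_le (E := E) (div_pos hε hy)
    refine le_of_tendsto hlim ?_
    filter_upwards [ha.eventually_ge_atTop (‖x‖ + ‖y‖ / δ)] with i hi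
    have h1 : ‖y‖ ≤ δ * ‖x - a i‖ := by
      rw [← div_le_iff₀' hδ]
      have := norm_sub_norm_le (a i) x
      rw [norm_sub_rev] at this
      linarith
    have h2 := H (x - a i) y h1
    rw [show x - a i + y = x + y - a i by abel, show x - a i - y = x - y - a i by abel] at h2
    have h3 : ε / (‖y‖ + 1) * ‖y‖ ≤ ε := by
      rw [div_mul_eq_mul_div, div_le_iff₀ hy]
      nlinarith
    linarith
  linarith

theorem UniformSmoothSpace.exists_strongDual_of_tendsto {E : Type*} [NormedAddCommGroup E]
    [NormedSpace ℝ E] [UniformSmoothSpace E] {ι : Type*} {l : Filter ι} [l.NeBot] {a : ι → E}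
    {h : E → ℝ} (ha : Tendsto (fun i => ‖a i‖) l atTop)
    (hh : ∀ x, Tendsto (fun i => internalMetricFunctional 0 (a i) x) l (𝓝 (h x))) :
    ∃ u : StrongDual ℝ E, ‖u‖ ≤ 1 ∧ ∀ x, h x = u x := by
  have J := UniformSmoothSpace.add_add_sub_eq_of_tendsto ha hh
  have hb (x : E) : |h x| ≤ ‖x‖ := by
    refine le_of_tendsto' (hh x).abs fun i => ?_
    rw [internalMetricFunctional_zero_apply]
    simpa [norm_sub_rev] using abs_norm_sub_norm_le (x - a i) (-a i)
  have h0 : h 0 = 0 := by simpa using hb 0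
  have h2 (x : E) : h (x + x) = 2 * h x := by
    have := J x x
    rwa [sub_self, h0, add_zero] at this
  -- Jensen's equation at the midpoint of `p` and `q`, combined with `h (x + x) = 2 * h x`.
  have hadd (p q : E) : h (p + q) = h p + h q := by
    have h1 := J ((1 / 2 : ℝ) • (p + q)) ((1 / 2 : ℝ) • (p - q))
    rw [← h2, show (1 / 2 : ℝ) • (p + q) + (1 / 2 : ℝ) • (p - q) = p by module,
      show (1 / 2 : ℝ) • (p + q) - (1 / 2 : ℝ) • (p - q) = q by module,
      show (1 / 2 : ℝ) • (p + q) + (1 / 2 : ℝ) • (p + q) = p + q by module] at h1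
    exact h1.symm
  let f : E →+ ℝ := ⟨⟨h, h0⟩, hadd⟩
  have hf : Continuous f :=
    AddMonoidHomClass.continuous_of_bound f 1 fun x => by simpa [f] using hb x
  refine ⟨f.toRealLinearMap hf, ContinuousLinearMap.opNorm_le_bound _ zero_le_one fun x => ?_,
    fun x => rfl⟩
  rw [one_mul]
  exact hb x

theorem ContinuousLinearMap.exists_norm_eq_one_lt_apply {E : Type*} [NormedAddCommGroup E]
    [NormedSpace ℝ E] [Nontrivial E] (f : StrongDual ℝ E) {r : ℝ} (hr : r < ‖f‖) :
    ∃ x : E, ‖x‖ = 1 ∧ r < f x := by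
  by_contra! H
  have H' (x : E) (hx : ‖x‖ = 1) : |f x| ≤ r := by
    refine abs_le.2 ⟨?_, H x hx⟩
    have := H (-x) (by rw [norm_neg, hx])
    rw [map_neg] at this
    linarith
  obtain ⟨x, hx⟩ := exists_norm_eq E zero_le_one
  exact hr.not_ge (f.opNorm_le_of_unit_norm ((abs_nonneg _).trans (H' x hx)) H')

/-- With `v` almost norming and `a = -(s • v)`, testing `u` on `x + s • v` bounds `h_a x` from
below. Testing it on `s • v - x` bounds `‖s • v - x‖` from below, and smoothness turns this into the
upper bound. The choice `s = R / δ` makes smoothness apply on the whole ball. -/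
theorem UniformSmoothSpace.exists_forall_abs_internalMetricFunctional_sub_le {E : Type*}
    [NormedAddCommGroup E] [NormedSpace ℝ E] [Nontrivial E] [UniformSmoothSpace E] {u : StrongDual ℝ E}
    (hu : ‖u‖ = 1) {R η : ℝ} (hR : 0 < R) (hη : 0 < η) :
    ∃ a : E, ∀ x : E, ‖x‖ ≤ R → |internalMetricFunctional 0 a x - u x| ≤ η := by
  obtain ⟨δ, hδ, H⟩ := UniformSmoothSpace.exists_forall_norm_add_norm_sub_le (E := E)
    (ε := η / (2 * R)) (by positivity)
  obtain ⟨v, hv, hκ⟩ := u.exists_norm_eq_one_lt_apply (r := 1 - η / (2 * (R / δ))) (by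
    rw [hu, sub_lt_self_iff]
    positivity)
  have hule (x : E) : u x ≤ ‖x‖ := by
    simpa [hu] using (le_abs_self _).trans (u.le_opNorm x)
  have hs : 0 < R / δ := by positivity
  set s := R / δ with hs'
  have hκ' : s - η / 2 ≤ s * u v := by
    have := mul_le_mul_of_nonneg_left hκ.le hs.le
    have e : s * (1 - η / (2 * s)) = s - η / 2 := by field_simp
    linarith
  have hsv : ‖s • v‖ = s := by rw [norm_smul, hv, mul_one, Real.norm_of_nonneg hs.le]
  refine ⟨-(s • v), fun x hx => ?_⟩
  rw [internalMetricFunctional_zero_apply, norm_neg, hsv, sub_neg_eq_add, abs_le]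
  have h1 := hule (x + s • v)
  have h2 := hule (s • v - x)
  have h3 := H (s • v) x (by rw [hsv, hs']; field_simp; exact hx)
  have h4 : η / (2 * R) * ‖x‖ ≤ η / 2 := by
    have := mul_le_mul_of_nonneg_left hx (show 0 ≤ η / (2 * R) by positivity)
    have e : η / (2 * R) * R = η / 2 := by field_simp
    linarith
  rw [map_add, map_smul, smul_eq_mul] at h1
  rw [map_sub, map_smul, smul_eq_mul] at h2
  rw [hsv, add_comm (s • v) x] at h3
  constructor <;> linarith

theorem UniformSmoothSpace.exists_tendsto_internalMetricFunctional {E : Type*}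
    [NormedAddCommGroup E] [NormedSpace ℝ E] [Nontrivial E] [UniformSmoothSpace E] {u : StrongDual ℝ E}
    {f : ℕ → StrongDual ℝ E} (hf : ∀ n, ‖f n‖ = 1)
    (hfu : ∀ x, Tendsto (fun n => f n x) atTop (𝓝 (u x))) :
    ∃ a : ℕ → E, ∀ x : E,
      Tendsto (fun n => internalMetricFunctional 0 (a n) x) atTop (𝓝 (u x)) := by
  choose a ha using fun n : ℕ =>
    UniformSmoothSpace.exists_forall_abs_internalMetricFunctional_sub_le (hf n)
      (R := n + 1) (η := 1 / ((n : ℝ) + 1)) (by positivity) (by positivity)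
  refine ⟨a, fun x => ?_⟩
  have h : Tendsto (fun n => internalMetricFunctional 0 (a n) x - f n x) atTop (𝓝 0) := by
    refine squeeze_zero_norm' ?_ (tendsto_one_div_add_atTop_nhds_zero_nat (𝕜 := ℝ))
    filter_upwards [eventually_ge_atTop ⌈‖x‖⌉₊] with n hn
    refine ha n x ?_
    have := Nat.ceil_le.1 hn
    linarith
  simpa using h.add (hfu x)

/-- Uniform convexity of the dual, by Lindenstrauss duality: for unit `x`, `y`, write `(f + g) x + t
* (f - g) y` as `f (x + t • y) + g (x - t • y)`, apply smoothness, then take suprema over `x` and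
`y`. -/
theorem UniformSmoothSpace.exists_forall_norm_add_add_norm_sub_le {E : Type*}
    [NormedAddCommGroup E] [NormedSpace ℝ E] [Nontrivial E] [UniformSmoothSpace E] {ε : ℝ} (hε : 0 < ε) :
    ∃ t : ℝ, 0 < t ∧ ∀ (f g : StrongDual ℝ E) (S : ℝ), ‖f‖ ≤ S → ‖g‖ ≤ S →
      ‖f + g‖ + t * ‖f - g‖ ≤ (2 + ε * t) * S := by
  obtain ⟨t, ht, H⟩ := UniformSmoothSpace.uniform_smooth (E := E) hε
  refine ⟨t, ht, fun f g S hf hg => ?_⟩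
  have hS : 0 ≤ S := (norm_nonneg f).trans hf
  have key (x : E) (hx : ‖x‖ = 1) (y : E) (hy : ‖y‖ = 1) :
      (f + g) x + t * (f - g) y ≤ (2 + ε * t) * S := by
    have hty : ‖t • y‖ ≤ t := by
      rw [norm_smul, Real.norm_of_nonneg ht.le]
      rw [hy, mul_one]
    have h1 : f (x + t • y) ≤ S * ‖x + t • y‖ := (le_abs_self _).trans (f.le_of_opNorm_le hf _)
    have h2 : g (x - t • y) ≤ S * ‖x - t • y‖ := (le_abs_self _).trans (g.le_of_opNorm_le hg _)
    have h3 := mul_le_mul_of_nonneg_left (H hx hty) hS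
    have h4 : S * (ε * ‖t • y‖) ≤ S * (ε * t) := by gcongr
    simp only [map_add, map_sub, map_smul, smul_eq_mul, add_apply, sub_apply] at h1 h2 ⊢
    linarith
  have key2 (y : E) (hy : ‖y‖ = 1) : ‖f + g‖ + t * (f - g) y ≤ (2 + ε * t) * S := by
    by_contra! hlt
    obtain ⟨x, hx, hlt⟩ := (f + g).exists_norm_eq_one_lt_apply (sub_lt_iff_lt_add.2 hlt)
    linarith [key x hx y hy]
  rw [← le_sub_iff_add_le', ← le_div_iff₀' ht]
  by_contra! hlt
  obtain ⟨y, hy, hlt⟩ := (f - g).exists_norm_eq_one_lt_apply hlt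
  rw [div_lt_iff₀' ht] at hlt
  linarith [key2 y hy]

theorem exists_strongDual_norm_eq_one_forall_mem_eq_zero {E : Type*} [NormedAddCommGroup E]
    [NormedSpace ℝ E] (hE : ¬ FiniteDimensional ℝ E) (X : Set E) (hX : X.Finite) :
    ∃ w : StrongDual ℝ E, ‖w‖ = 1 ∧ ∀ x ∈ X, w x = 0 := by
  set p := Submodule.span ℝ X
  have : FiniteDimensional ℝ p := FiniteDimensional.span_of_finite ℝ hX
  have hp : p ≠ ⊤ := fun h => hE (Module.finite_def.2 (h ▸ Submodule.fg_span hX))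
  obtain ⟨z, hz⟩ : ∃ z, z ∉ p := by
    by_contra! h
    exact hp (Submodule.eq_top_iff'.2 h)
  have : IsClosed (p : Set E) := p.closed_of_finiteDimensional
  obtain ⟨g, -, hg⟩ := exists_dual_vector'' ℝ (p.mkQL z)
  set f : StrongDual ℝ E := g.comp p.mkQL
  have hf : f ≠ 0 := by
    intro h
    have hfz : f z = 0 := by rw [h]; rfl
    have h0 : ‖p.mkQL z‖ = 0 := by simpa [f] using hg.symm.trans hfz
    exact hz ((Submodule.Quotient.mk_eq_zero p).1 (norm_eq_zero.1 h0))
  refine ⟨‖f‖⁻¹ • f, ?_, fun x hx => ?_⟩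
  · rw [norm_smul, norm_inv, norm_norm, inv_mul_cancel₀ (norm_ne_zero_iff.2 hf)]
  · have : p.mkQL x = 0 := (Submodule.Quotient.mk_eq_zero p).2 (Submodule.subset_span hx)
    simp [f, this]

/-- In the dual of an infinite-dimensional space there are normalized sequences whose finite sums
behave like those of a basic sequence. -/
theorem exists_seq_strongDual_norm_sum_le_norm_sum_sub {E : Type*} [NormedAddCommGroup E]
    [NormedSpace ℝ E] (hE : ¬ FiniteDimensional ℝ E) :
    ∃ w : ℕ → StrongDual ℝ E, (∀ n, ‖w n‖ = 1) ∧ ∀ (n : ℕ) (F G : Finset ℕ),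
      (∀ i ∈ F, i < n) → (∀ i ∈ G, n ≤ i) →
      ‖∑ i ∈ F, w i‖ ≤ 2 * ‖∑ i ∈ F, w i - ∑ i ∈ G, w i‖ := by
  classical
  have : Nontrivial E := by
    by_contra h
    rw [not_nontrivial_iff_subsingleton] at h
    exact hE inferInstance
  have hnorming (f : StrongDual ℝ E) : ∃ x : E, ‖x‖ = 1 ∧ ‖f‖ ≤ 2 * f x := by
    rcases eq_or_ne f 0 with rfl | hf
    · obtain ⟨x, hx⟩ := exists_norm_eq E zero_le_one
      exact ⟨x, hx, by simp⟩
    · obtain ⟨x, hx, h⟩ := f.exists_norm_eq_one_lt_apply (half_lt_self (norm_pos_iff.2 hf))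
      exact ⟨x, hx, by linarith⟩
  choose x hx hfx using hnorming
  choose g hg hgx using fun S : Finset (StrongDual ℝ E) =>
    exists_strongDual_norm_eq_one_forall_mem_eq_zero hE (x '' S) (S.finite_toSet.image x)
  -- `S n` collects all subset sums of the first `n` functionals. The next one vanishes at the
  -- half-norming vector of each, so later terms cannot cancel a partial sum.
  let S : ℕ → Finset (StrongDual ℝ E) := fun n =>
    Nat.rec {0} (fun _ T => T ∪ T.image (· + g T)) n
  have hS (n : ℕ) : S (n + 1) = S n ∪ (S n).image (· + g (S n)) := rfl
  have hSmono : Monotone S := monotone_nat_of_le_succ fun n => by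
    rw [hS]
    exact Finset.subset_union_left
  have hsum (n : ℕ) : ∀ F : Finset ℕ, (∀ i ∈ F, i < n) → ∑ i ∈ F, g (S i) ∈ S n := by
    induction n with
    | zero =>
      intro F hF
      rw [Finset.eq_empty_of_forall_notMem fun i hi => (hF i hi).not_ge (Nat.zero_le i)]
      simp [S]
    | succ n ih =>
      intro F hF
      have h := ih (F.erase n) fun i hi => by
        have := hF i (Finset.mem_of_mem_erase hi)
        have := Finset.ne_of_mem_erase hi
        omega
      rw [hS, Finset.mem_union]
      by_cases hn : n ∈ F
      · exact Or.inr (Finset.mem_image.2 ⟨_, h, Finset.sum_erase_add _ _ hn⟩)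
      · exact Or.inl (by rwa [Finset.erase_eq_of_notMem hn] at h)
  refine ⟨fun n => g (S n), fun n => hg _, fun n F G hF hG => ?_⟩
  have hmem := hsum n F hF
  set f := ∑ i ∈ F, g (S i)
  have h0 : (∑ i ∈ G, g (S i)) (x f) = 0 := by
    rw [sum_apply]
    exact Finset.sum_eq_zero fun i hi =>
      hgx _ _ ⟨f, Finset.mem_coe.2 (hSmono (hG i hi) hmem), rfl⟩
  have h1 : f (x f) ≤ ‖f - ∑ i ∈ G, g (S i)‖ := by
    have := (le_abs_self _).trans ((f - ∑ i ∈ G, g (S i)).le_opNorm (x f))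
    rwa [sub_apply, h0, sub_zero, hx, mul_one] at this
  linarith [hfx f]

/-- Uniform smoothness forces the averages of a sequence as above to tend to zero in norm. -/
theorem UniformSmoothSpace.exists_forall_norm_sum_le_pow {E : Type*}
    [NormedAddCommGroup E] [NormedSpace ℝ E] [Nontrivial E] [UniformSmoothSpace E]
    {w : ℕ → StrongDual ℝ E} (hw : ∀ n, ‖w n‖ = 1)
    (hwsum : ∀ (n : ℕ) (F G : Finset ℕ), (∀ i ∈ F, i < n) → (∀ i ∈ G, n ≤ i) →
      ‖∑ i ∈ F, w i‖ ≤ 2 * ‖∑ i ∈ F, w i - ∑ i ∈ G, w i‖) :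
    ∃ ρ : ℝ, 0 < ρ ∧ ρ < 2 ∧ ∀ (k : ℕ) (φ : ℕ → ℕ), StrictMono φ →
      ‖∑ i ∈ Finset.range (2 ^ k), w (φ i)‖ ≤ ρ ^ k := by
  obtain ⟨t, ht, H⟩ := UniformSmoothSpace.exists_forall_norm_add_add_norm_sub_le (E := E)
    (ε := 1 / 4) (by norm_num)
  -- For half-blocks `f`, `g` of norm at most `ρ ^ k`, separation gives `‖f - g‖ ≥ ‖f‖ / 2 ≥ (‖f +
  -- g‖ - ρ ^ k) / 2`. Convexity then yields `(1 + t / 2) * ‖f + g‖ ≤ (2 + t / 4 + t / 2) * ρ ^ k`.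
  refine ⟨(2 + 3 / 4 * t) / (1 + t / 2), by positivity, ?_, fun k => ?_⟩
  · rw [div_lt_iff₀ (by positivity)]
    linarith
  set ρ := (2 + 3 / 4 * t) / (1 + t / 2) with hρ
  induction k with
  | zero => intro φ _; simp [hw]
  | succ k ih =>
    intro φ hφ
    have h1 := ih φ hφ
    have h2 := ih (fun i => φ (2 ^ k + i)) fun i j hij => hφ (by omega)
    have hsep := hwsum (φ (2 ^ k)) ((Finset.range (2 ^ k)).map ⟨φ, hφ.injective⟩)
      ((Finset.range (2 ^ k)).map ⟨fun i => φ (2 ^ k + i), fun i j hij => by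
        simpa using hφ.injective hij⟩)
      (by
        simp only [Finset.mem_map, Finset.mem_range]
        rintro _ ⟨i, hi, rfl⟩
        exact hφ hi)
      (by
        simp only [Finset.mem_map, Finset.mem_range]
        rintro _ ⟨i, -, rfl⟩
        exact hφ.monotone (Nat.le_add_right _ _))
    simp only [Finset.sum_map, Function.Embedding.coeFn_mk] at hsep
    rw [pow_succ 2, mul_two, Finset.sum_range_add, pow_succ ρ]
    set f := ∑ i ∈ Finset.range (2 ^ k), w (φ i)
    set g := ∑ i ∈ Finset.range (2 ^ k), w (φ (2 ^ k + i))
    have h3 := H f g _ h1 h2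
    have h4 := norm_add_le f g
    have h5 : t * ‖f‖ ≤ t * (2 * ‖f - g‖) := mul_le_mul_of_nonneg_left hsep ht.le
    have h6 : t * ‖f + g‖ ≤ t * (‖f‖ + ρ ^ k) := by gcongr; linarith
    rw [hρ, mul_div_assoc', ← hρ, le_div_iff₀ (by positivity)]
    linarith

theorem UniformSmoothSpace.exists_seq_strongDual_norm_eq_one_tendsto_zero {E : Type*}
    [NormedAddCommGroup E] [NormedSpace ℝ E] [Nontrivial E] [UniformSmoothSpace E]
    (hE : ¬ FiniteDimensional ℝ E) :
    ∃ w : ℕ → StrongDual ℝ E, (∀ n, ‖w n‖ = 1) ∧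
      ∀ x, Tendsto (fun n => w n x) atTop (𝓝 0) := by
  obtain ⟨w, hw, hwsum⟩ := exists_seq_strongDual_norm_sum_le_norm_sum_sub hE
  obtain ⟨ρ, hρ0, hρ2, hρ⟩ := UniformSmoothSpace.exists_forall_norm_sum_le_pow hw hwsum
  -- Otherwise a subsequence stays `≥ ε` at `x`, so its sums of `2 ^ k` terms are at least `2 ^ k *
  -- ε` there, against the bound `ρ ^ k * ‖x‖` with `ρ < 2`. Applying this to `-x` too gives the
  -- two-sided bound.
  have key (x : E) {ε : ℝ} (hε : 0 < ε) : ∀ᶠ n in atTop, w n x < ε := by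
    by_contra hcon
    obtain ⟨φ, hφ, hφx⟩ := extraction_of_frequently_atTop (not_eventually.1 hcon)
    have hle (k : ℕ) : ε ≤ (ρ / 2) ^ k * ‖x‖ := by
      have h1 := (le_abs_self _).trans (ContinuousLinearMap.le_of_opNorm_le _ (hρ k φ hφ) x)
      rw [sum_apply] at h1
      have h2 := Finset.card_nsmul_le_sum (Finset.range (2 ^ k)) (fun i => w (φ i) x) ε
        fun i _ => not_lt.1 (hφx i)
      rw [Finset.card_range, nsmul_eq_mul] at h2
      push_cast at h2
      rw [div_pow, div_mul_eq_mul_div, le_div_iff₀' (by positivity)]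
      exact h2.trans h1
    have hlim : Tendsto (fun k => (ρ / 2) ^ k * ‖x‖) atTop (𝓝 (0 * ‖x‖)) :=
      (tendsto_pow_atTop_nhds_zero_of_lt_one (by positivity) (by linarith)).mul_const _
    rw [zero_mul] at hlim
    exact hε.not_ge (ge_of_tendsto' hlim hle)
  refine ⟨w, hw, fun x => Metric.tendsto_nhds.2 fun ε hε => ?_⟩
  filter_upwards [key x hε, key (-x) hε] with n h1 h2
  rw [map_neg] at h2
  rw [Real.dist_eq, sub_zero, abs_lt]
  constructor <;> linarith

/-- Moves `u` to the unit sphere along `w`; the uniform bound on `c` keeps the perturbations weak-*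
null. -/
theorem exists_norm_add_smul_eq_one {F : Type*} [NormedAddCommGroup F] [NormedSpace ℝ F]
    {u w : F} (hu : ‖u‖ ≤ 1) (hw : ‖w‖ = 1) : ∃ c : ℝ, |c| ≤ 2 ∧ ‖u + c • w‖ = 1 := by
  have hcont : ContinuousOn (fun c : ℝ => ‖u + c • w‖) (Set.Icc 0 2) := by fun_prop
  have h2 : 1 ≤ ‖u + (2 : ℝ) • w‖ := by
    have := norm_sub_le (u + (2 : ℝ) • w) u
    rw [add_sub_cancel_left, norm_smul, hw] at this
    norm_num at this
    linarith
  obtain ⟨c, hc, h⟩ := intermediate_value_Icc zero_le_two hcont ⟨by simpa using hu, h2⟩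
  exact ⟨c, by rw [abs_of_nonneg hc.1]; exact hc.2, h⟩

theorem UniformSmoothSpace.exists_seq_tendsto_of_not_finiteDimensional {E : Type*}
    [NormedAddCommGroup E] [NormedSpace ℝ E] [Nontrivial E] [UniformSmoothSpace E]
    (hE : ¬ FiniteDimensional ℝ E) {u : StrongDual ℝ E} (hu : ‖u‖ ≤ 1) :
    ∃ a : ℕ → E, ∀ x : E,
      Tendsto (fun n => internalMetricFunctional 0 (a n) x) atTop (𝓝 (u x)) := by
  obtain ⟨w, hw, hw0⟩ :=
    UniformSmoothSpace.exists_seq_strongDual_norm_eq_one_tendsto_zero hE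
  choose c hc hcw using fun n => exists_norm_add_smul_eq_one hu (hw n)
  refine UniformSmoothSpace.exists_tendsto_internalMetricFunctional hcw fun x => ?_
  have h : Tendsto (fun n => c n * w n x) atTop (𝓝 0) := by
    refine squeeze_zero_norm (a := fun n => 2 * ‖w n x‖) (fun n => ?_) ?_
    · rw [norm_mul]
      exact mul_le_mul_of_nonneg_right (hc n) (norm_nonneg _)
    · simpa using (hw0 x).norm.const_mul 2
  simpa using h.const_add (u x)

theorem mainTheorem8 {E : Type*} [NormedAddCommGroup E] [NormedSpace ℝ E] [CompleteSpace E]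
    [UniformSmoothSpace E] :
    (∀ h ∈ metricFunctionals E 0,
      ∀ {ι : Type*} [Preorder ι] [IsDirectedOrder ι] [Nonempty ι] (a : ι → E),
        Tendsto (fun α => ‖a α‖) atTop atTop →
        (∀ x : E, Tendsto (fun α => internalMetricFunctional 0 (a α) x) atTop (𝓝 (h x))) →
        ∃ u : StrongDual ℝ E, ‖u‖ ≤ 1 ∧ ∀ x : E, h x = u x) ∧
    (∀ u : StrongDual ℝ E, ‖u‖ ≤ 1 → (¬ FiniteDimensional ℝ E ∨ ‖u‖ = 1) →
      ∃ a : ℕ → E, ∀ x : E,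
        Tendsto (fun n => internalMetricFunctional 0 (a n) x) atTop (𝓝 (u x))) := by
  refine ⟨fun h _ ι _ _ _ a ha hh => UniformSmoothSpace.exists_strongDual_of_tendsto ha hh,
    fun u hu h => ?_⟩
  have : Nontrivial E := by
    by_contra hE
    rw [not_nontrivial_iff_subsingleton] at hE
    rcases h with h | h
    · exact h inferInstance
    · rw [Subsingleton.elim u 0, norm_zero] at h
      exact zero_ne_one h
  rcases h with h | h
  · exact UniformSmoothSpace.exists_seq_tendsto_of_not_finiteDimensional h hu
  · exact UniformSmoothSpace.exists_tendsto_internalMetricFunctional (f := fun _ => u)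
      (fun _ => h) fun x => tendsto_const_nhds
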